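/- \textbf{Setting.} Let $d\in\mathbb N$ and let $\alpha=(\alpha_i)_{i\ge1}$, $\beta=(\beta_i)_{i\ge 1}$ be finitely supported sequences in $\mathbb N$ with $d-\sum_i i\alpha_i+\sum_i i\beta_i=0$. Let $\Delta=\Delta_d^3(\alpha,\beta)$ be the labelled multiset in $\mathbb Z^3$ of $d$ copies each of $(1,1,1),(-1,0,0),(0,-1,0)$ and, for $i\ge1$, of $\alpha_i$ copies of $(0,0,-i)$ and $\beta_i$ copies of $(0,0,i)$. A rational tropical stable map $C=(\Gamma,h)$ to $\mathbb R^3$ of degree $\Delta$ with $n\geq 1$ contracted ends is a metric tree $\Gamma$ with all vertices of valence $\ge3$ and with $N=n+\#\Delta$ labelled unbounded ends, together with a map $h:\Gamma\to\mathbb R^3$ that is affine linear with integer direction vectors on edges, balanced at each vertex, constant on the first $n$ ends, and whose other ends have the direction vectors prescribed by $\Delta$. Let $\pi:\mathbb R^3\to\mathbb R^2$ forget the last coordinate. Consider the following conditions on $C$, where $\eta,\kappa$ are disjoint sets of labels of ends of $C$ of primitive direction $(0,0,\pm1)$: the $i$-th contracted end is mapped to a given point $p_i\in\mathbb R^3$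 ($i=1,\dots,n$); $\pi\circ h$ maps the end $f$ to a given point $P_f\in\mathbb R^2$ for $f\in\eta$; $\pi\circ h$ maps the end $f$ into a given tropical multi line $L_f\subset\mathbb R^2$ for $f\in\kappa$ (one vertex and three ends of directions $(1,1),(-1,0),(0,-1)$, of common weight $\omega(L_f)\geq 1$); and $C$ satisfies given degenerated cross-ratios $\lambda_1,\dots,\lambda_l$ (sets of four labels of ends). Let $\mathcal M_{0,n}(\mathbb R^3,\Delta)\cong\mathcal M_{0,N}\times\mathbb R^3$ be the tropical moduli space of these maps and $X=\prod_j\operatorname{ft}_{\lambda_j}^*(0)\cdot\mathcal M_{0,n}(\mathbb R^3,\Delta)$ the tropical intersection product, where $\operatorname{ft}_{\lambda_j}$ is the forgetful map to $\mathcal M_{0,4}$. The map $C$ \emph{contributes} to the number $N_{\Delta}(p,L,P,\lambda)$ if it satisfies the conditions, lies in the relative interior of a top-dimensional cell of $X$, and its multiplicity, that is, the weight of this cell in $X$ times the absolute value of the determinant of the ev-matrix, is nonzero. (The ev-matrix is the matrix of the linear part, in the coordinates of the cell given by the position of a base vertex and the lengths of the bounded edges, of the evaluations at $p_i$, $P_f$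 and, for $f\in\kappa$, of $\omega(L_f)$ times a primitive linear form vanishing on the end of $L_f$ on which $f$ lies. If $f$ is mapped to the vertex of $L_f$, the determinant is required to be nonzero for some choice of the end of $L_f$.) An \emph{elevator} of $C$ is an edge of primitive direction $(0,0,\pm1)$, and a \emph{floor} of $C$ is a connected component of what remains of $C$ if the interiors of all elevators are removed. $C$ is \emph{floor decomposed} if each of the points $p_1,\dots,p_n$ lies on its own floor, i.e. different points lie on different floors. \textbf{Statement.} For all $d,\alpha,\beta$ and $n\ge 1$ as above there is a constant $c>0$, depending only on $d,\alpha,\beta,n$, such that the following holds. Let $\varepsilon>0$, $B_\varepsilon=(-\varepsilon,\varepsilon)^2$, and let conditions as above be given in stretched configuration, i.e. $P_f\in B_\varepsilon$ for $f\in\eta$, the vertex of $L_f$ lies in $B_\varepsilon$ for $f\in\kappa$, $\pi(p_i)\in B_\varepsilon$ for all $i$, and the $z$-coordinates of any two different points $p_i,p_j$ satisfy $|p_{i,z}-p_{j,z}|>c\,\varepsilon$. Assume that each entry of each $\lambda_j$ is the label of a contracted end or of an end of primitive direction $(0,0,\pm1)$. Then every rational tropical stable map of degree $\Delta_d^3(\alpha,\beta)$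 to $\mathbb R^3$ that contributes to $N_{\Delta_d^3(\alpha,\beta)}(p,L,P,\lambda)$ is floor decomposed. -/

import Mathlib

namespace TropCurve

/-! ### Degrees -/

/-- The vector `(1,1,1)`. -/
def e0 : Fin 3 → ℤ := ![1, 1, 1]

/-- The multiset `Δ_d^3(α,β)`: `d` copies each of `(1,1,1)`, `(-1,0,0)`, `(0,-1,0)`, together with
`α i` copies of `(0,0,-i)` and `β i` copies of `(0,0,i)` for every `i ≥ 1`. -/
def spaceDegree (d : ℕ) (α β : ℕ+ →₀ ℕ) : Multiset (Fin 3 → ℤ) :=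
  Multiset.replicate d e0 + Multiset.replicate d ![-1, 0, 0] + Multiset.replicate d ![0, -1, 0]
    + α.sum (fun i a => Multiset.replicate a ![0, 0, -((i : ℕ) : ℤ)])
    + β.sum (fun i b => Multiset.replicate b ![0, 0, ((i : ℕ) : ℤ)])

/-- `d - ∑ i α_i + ∑ i β_i = 0`, so that the entries of `Δ_d^3(α,β)` sum up to zero. -/
def IsBalancedDegree (d : ℕ) (α β : ℕ+ →₀ ℕ) : Prop :=
  d + β.sum (fun i b => (i : ℕ) * b) = α.sum (fun i a => (i : ℕ) * a)

/-- `Δ : Fin k → ℤ³` is a labelling of the multiset `Δ_d^3(α,β)` by `k` labels. -/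
def IsLabelledDegree (d : ℕ) (α β : ℕ+ →₀ ℕ) {k : ℕ} (Δ : Fin k → Fin 3 → ℤ) : Prop :=
  Finset.univ.val.map Δ = spaceDegree d α β

/-- The primitive direction of `v` is `(0,0,1)` or `(0,0,-1)`. -/
def IsVertical (v : Fin 3 → ℤ) : Prop := v 0 = 0 ∧ v 1 = 0 ∧ v 2 ≠ 0

/-- Labels of ends: `Sum.inl i` are the contracted ends, `Sum.inr a` the end of direction `Δ a`. -/
abbrev Label (n k : ℕ) := Fin n ⊕ Fin k

/-- Direction vector of an end, pointing away from its vertex. -/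
def endDir {n k : ℕ} (Δ : Fin k → Fin 3 → ℤ) : Label n k → Fin 3 → ℤ :=
  Sum.elim (fun _ => 0) Δ

/-! ### Rational tropical stable maps -/

open scoped Classical in
/-- A rational tropical stable map to `ℝ³` of degree `Δ` with `n` contracted ends: a metric tree on
the vertex set `V` (bounded edges are the edges of `graph`, ends are attached by `attach`), all of
whose vertices have valence at least `3`, and a balanced map that is integer affine linear on edges.
The map is recorded by the positions of the vertices and by the direction vectors `dir u w` of the
bounded edge `uw` at `u`. -/
structure StableMap (n : ℕ) {k : ℕ} (Δ : Fin k → Fin 3 → ℤ) (V : Type*) [Fintype V] where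
  graph : SimpleGraph V
  isTree : graph.IsTree
  attach : Label n k → V
  length : Sym2 V → ℝ
  length_pos : ∀ e ∈ graph.edgeSet, 0 < length e
  three_le_valence : ∀ v, 3 ≤ (Finset.univ.filter fun w => graph.Adj v w).card
    + (Finset.univ.filter fun x => attach x = v).card
  pos : V → Fin 3 → ℝ
  dir : V → V → Fin 3 → ℤ
  affine : ∀ u w, graph.Adj u w → ∀ t, pos w t = pos u t + length s(u, w) * dir u w t
  balanced : ∀ v, (∑ w ∈ Finset.univ.filter (fun w => graph.Adj v w), dir v w)
    + (∑ x ∈ Finset.univ.filter (fun x => attach x = v), endDir Δ x) = 0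

/-- The projection `π : ℝ³ → ℝ²` that forgets the last coordinate. -/
def proj (q : Fin 3 → ℝ) : Fin 2 → ℝ := ![q 0, q 1]

/-! ### The fan `M_{0,N}` and divisors of functions on it

`I` is the set of labels and `r : I` an auxiliary label. A bounded edge of an `I`-marked tree
induces a split of `I` into two parts, and a split is recorded by its part that does not contain
`r`. Combinatorial types of `I`-marked trees are the systems of pairwise compatible splits. -/

section Moduli

variable {I : Type*} [Fintype I] [DecidableEq I]

/-- Cones of `M_{0,N}`, each given by the splits of the bounded edges of its trees. -/
def IsCone (r : I) (τ : Finset (Finset I)) : Prop :=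
  (∀ A ∈ τ, r ∉ A ∧ 2 ≤ A.card ∧ 2 ≤ Aᶜ.card) ∧
  ∀ A ∈ τ, ∀ B ∈ τ, Disjoint A B ∨ A ⊆ B ∨ B ⊆ A

/-- Maximal cones of `M_{0,N}`; they all have dimension `N - 3`. -/
def IsFacet (r : I) (τ : Finset (Finset I)) : Prop :=
  IsCone r τ ∧ ∀ σ, IsCone r σ → τ ⊆ σ → σ = τ

/-- The vector of all distances of ends in the tree with one bounded edge, of length one, that
induces the split `A`. Modulo the range of `endShift`, this is the primitive generator of the ray of
`M_{0,N}` of that split. -/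
def splitVec (A : Finset I) : I → I → ℝ := fun i j => if i ∈ A ↔ j ∈ A then 0 else 1

/-- `M_{0,N}` is embedded into the quotient of the space of distance vectors by the range of
`a ↦ (a_i + a_j)_{i ≠ j}`. -/
def endShift (a : I → ℝ) : I → I → ℝ := fun i j => if i = j then 0 else a i + a j

open scoped Classical in
/-- The new rays by which `τ` extends to a cone that contains it as a face of codimension one. -/
noncomputable def newRays (r : I) (τ : Finset (Finset I)) : Finset (Finset I) :=
  Finset.univ.filter fun A => A ∉ τ ∧ IsCone r (insert A τ)

open scoped Classical in
/-- The weight on the cone `τ` of the divisor of `φ` on the cycle with weights `W`, where `φ` is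
the function that is linear on all cones and has the value `φ A` on the generator of the ray of `A`:
`∑_σ φ_σ(W(σ) v_{σ/τ}) - φ_τ(∑_σ W(σ) v_{σ/τ})`, where the sum is over the cones `σ` that contain
`τ` as a face of codimension one and `c` are the coordinates of `∑_σ W(σ) v_{σ/τ}` in the span of
`τ` (which exist because the cycle is balanced). -/
noncomputable def divisorWeight (r : I) (φ : Finset I → ℝ) (W : Finset (Finset I) → ℝ)
    (τ : Finset (Finset I)) : ℝ :=
  if h : IsCone r τ ∧ ∃ c : Finset I → ℝ, ∃ a : I → ℝ,
      (∑ A ∈ newRays r τ, W (insert A τ) • splitVec A) = (∑ B ∈ τ, c B • splitVec B) + endShift a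
  then (∑ A ∈ newRays r τ, W (insert A τ) * φ A) - ∑ B ∈ τ, h.2.choose B * φ B
  else 0

/-- The pull-back along the forgetful map to `M_{0,4}` of the function on `M_{0,4}` that is the
canonical coordinate on the ray `(b₀b₁|b₂b₃)` and zero on the other two rays. The divisor of the
latter function is the vertex of `M_{0,4}` with weight one. -/
def crossRatioFun (b : Fin 4 ↪ I) (A : Finset I) : ℝ :=
  if (b 0 ∈ A ∧ b 1 ∈ A ∧ b 2 ∉ A ∧ b 3 ∉ A) ∨ (b 0 ∉ A ∧ b 1 ∉ A ∧ b 2 ∈ A ∧ b 3 ∈ A)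
  then 1 else 0

open scoped Classical in
/-- The weight of the intersection product `∏_j ft_{λ_j}^*(0) · M_{0,N}` on the cone `τ`, for a list
of degenerated cross-ratios `λ_j`. -/
noncomputable def crossRatioWeight (r : I) : List (Fin 4 ↪ I) → Finset (Finset I) → ℝ
  | [] => fun τ => if IsFacet r τ then 1 else 0
  | b :: bs => divisorWeight r (crossRatioFun b) (crossRatioWeight r bs)

end Moduli

/-! ### Conditions -/

/-- A tropical multi line in `ℝ²`, given by its vertex and the weight of its three ends. -/
structure MultiLine where
  vertex : Fin 2 → ℝ
  weight : ℕ
  weight_pos : 0 < weight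

/-- The standard directions of `ℝ²`. -/
def stdDir : Fin 3 → Fin 2 → ℤ := ![![1, 1], ![-1, 0], ![0, -1]]

/-- `q` lies on the (closed) end number `s` of the multi line. -/
def MultiLine.OnEnd (L : MultiLine) (s : Fin 3) (q : Fin 2 → ℝ) : Prop :=
  ∃ t : ℝ, 0 ≤ t ∧ ∀ i, q i = L.vertex i + t * stdDir s i

/-- The coefficients of the primitive linear form that vanishes on the standard direction `s`. -/
def normalForm (s : Fin 3) : Fin 2 → ℤ := ![-(stdDir s 1), stdDir s 0]

/-- Point conditions `p`, codimension one tangency conditions `P` on the ends with labels in `η`,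
codimension two tangency conditions `L` on the ends with labels in `κ`, and degenerated
cross-ratios `cr`, the set of entries of each of which is enumerated in some order. The values of
`P` outside `η` and of `L` outside `κ` have no meaning. -/
structure Conditions (n : ℕ) {k : ℕ} (Δ : Fin k → Fin 3 → ℤ) where
  p : Fin n → Fin 3 → ℝ
  η : Finset (Fin k)
  κ : Finset (Fin k)
  η_vertical : ∀ f ∈ η, IsVertical (Δ f)
  κ_vertical : ∀ f ∈ κ, IsVertical (Δ f)
  disjoint : Disjoint η κ
  P : Fin k → Fin 2 → ℝ
  L : Fin k → MultiLine
  l : ℕ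
  cr : Fin l → (Fin 4 ↪ Label n k)

/-- Each entry of each cross-ratio is a contracted end or an end of primitive direction
`(0,0,±1)`. -/
def Conditions.EntriesVertical {n k : ℕ} {Δ : Fin k → Fin 3 → ℤ} (S : Conditions n Δ) : Prop :=
  ∀ j t a, S.cr j t = Sum.inr a → IsVertical (Δ a)

/-- The box `(-ε,ε) × (-ε,ε)`. -/
def box (ε : ℝ) : Set (Fin 2 → ℝ) := {q | ∀ i, |q i| < ε}

/-- The conditions are stretched with respect to the box of size `ε`, where "large compared to `ε`"
means larger than `c * ε`. -/
def Conditions.Stretched {n k : ℕ} {Δ : Fin k → Fin 3 → ℤ} (S : Conditions n Δ) (c ε : ℝ) : Prop :=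
  (∀ f ∈ S.η, S.P f ∈ box ε) ∧ (∀ f ∈ S.κ, (S.L f).vertex ∈ box ε) ∧
  (∀ i, proj (S.p i) ∈ box ε) ∧ ∀ i j, i ≠ j → c * ε < |S.p i 2 - S.p j 2|

namespace StableMap

variable {n k : ℕ} {Δ : Fin k → Fin 3 → ℤ} {V : Type*} [Fintype V]

/-- The labels of the ends on the side of `w` of the bounded edge `uw`. -/
noncomputable def side (C : StableMap n Δ V) (u w : V) : Finset (Label n k) :=
  open scoped Classical in
  Finset.univ.filter fun x => (C.graph.deleteEdges {s(u, w)}).Reachable w (C.attach x)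

/-- The cone of `M_{0,N}` whose relative interior contains the marked tree of `C`. -/
noncomputable def cone (C : StableMap n Δ V) (r : Label n k) : Finset (Finset (Label n k)) :=
  open scoped Classical in
  Finset.univ.filter fun A => r ∉ A ∧ ∃ u w, C.graph.Adj u w ∧ A = C.side u w

/-- The unique path between two vertices. -/
noncomputable def path (C : StableMap n Δ V) (u w : V) : C.graph.Walk u w :=
  (C.isTree.existsUnique_path u w).choose

/-- The coordinates on the cell of `C` in the moduli space of stable maps: the position of the
vertex of the base end `r`, and the lengths of the bounded edges. -/
abbrev Coord (C : StableMap n Δ V) := Fin 3 ⊕ C.graph.edgeSet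

/-- The matrix entries of the evaluation at the end `x`: its position is the position of the vertex
of `r`, plus the sum of `length e • dir e` over the edges on the path from there to `x`. -/
noncomputable def evCoeff (C : StableMap n Δ V) (r x : Label n k) (t : Fin 3) : C.Coord → ℤ :=
  open scoped Classical in
  Sum.elim (fun s => if s = t then 1 else 0) fun e =>
    ((C.path (C.attach r) (C.attach x)).darts.map fun a =>
      if a.edge = (e : Sym2 V) then C.dir a.fst a.snd t else 0).sum

/-- The rows of the ev-matrix: three for each point, two for each codimension one and one for each
codimension two tangency condition. -/
abbrev Row (S : Conditions n Δ) := (Fin n × Fin 3) ⊕ (S.η × Fin 2) ⊕ S.κ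

/-- The ev-matrix, if the end `f ∈ κ` of `C` meets `L f` in its end number `ρ f`. -/
noncomputable def evMatrix (C : StableMap n Δ V) (S : Conditions n Δ) (r : Label n k)
    (ρ : Fin k → Fin 3) : Matrix (Row S) C.Coord ℝ :=
  Matrix.of <| Sum.elim (fun it y => (C.evCoeff r (Sum.inl it.1) it.2 y : ℝ)) <|
    Sum.elim (fun ft y => (C.evCoeff r (Sum.inr ft.1) ft.2.castSucc y : ℝ)) fun f y =>
      (S.L f).weight *
        ∑ i : Fin 2, (normalForm (ρ f) i : ℝ) * C.evCoeff r (Sum.inr f) i.castSucc y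

/-- The absolute value of the determinant of the ev-matrix, which does not depend on the order of
the rows and columns; it is zero if the matrix is not a square matrix. -/
noncomputable def evMult (C : StableMap n Δ V) (S : Conditions n Δ) (r : Label n k)
    (ρ : Fin k → Fin 3) : ℝ :=
  open scoped Classical in
  if h : Nonempty (Row S ≃ C.Coord) then |((C.evMatrix S r ρ).submatrix id h.some).det| else 0

/-- The weight with which `C` contributes to the intersection product: the weight of its cell in
`∏_j ft_{λ_j}^*(0) · M_{0,n}(ℝ³,Δ)` times the ev-multiplicity. -/
noncomputable def mult (C : StableMap n Δ V) (S : Conditions n Δ) (r : Label n k)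
    (ρ : Fin k → Fin 3) : ℝ :=
  crossRatioWeight r (List.ofFn S.cr) (C.cone r) * C.evMult S r ρ

/-- `C` contributes to `N_Δ(S)`: it satisfies the point and tangency conditions, it lies in the
relative interior of a top-dimensional cell of the intersection product of the cross-ratio
conditions, and its multiplicity is nonzero. If `C` meets `L f` in the vertex of `L f`, then its
weight in the intersection product is nonzero if and only if this holds for some choice of ends of
the multi lines. -/
def Contributes [NeZero n] (C : StableMap n Δ V) (S : Conditions n Δ) : Prop :=
  (∀ i, C.pos (C.attach (Sum.inl i)) = S.p i) ∧
  (∀ f ∈ S.η, proj (C.pos (C.attach (Sum.inr f))) = S.P f) ∧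
  ∃ ρ : Fin k → Fin 3,
    (∀ f ∈ S.κ, (S.L f).OnEnd (ρ f) (proj (C.pos (C.attach (Sum.inr f))))) ∧
    C.mult S (Sum.inl 0) ρ ≠ 0

/-- The graph that remains if the interiors of the elevators are removed. -/
def floorGraph (C : StableMap n Δ V) : SimpleGraph V where
  Adj u w := C.graph.Adj u w ∧ ¬ IsVertical (C.dir u w) ∧ ¬ IsVertical (C.dir w u)
  symm := ⟨fun _ _ h => ⟨h.1.symm, h.2.2, h.2.1⟩⟩
  loopless := ⟨fun _ h => h.1.ne rfl⟩

/-- The floor on which the `i`-th point condition lies. -/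
def floorOf (C : StableMap n Δ V) (i : Fin n) : C.floorGraph.ConnectedComponent :=
  C.floorGraph.connectedComponentMk (C.attach (Sum.inl i))

/-- Each of the points lies on its own floor. -/
def FloorDecomposed (C : StableMap n Δ V) : Prop := Function.Injective C.floorOf

end StableMap

end TropCurve

/-! The curve is first confined over the box; then the vertical extent of each floor is estimated.

Suppose that some vertex leaves the box in one of the four directions `±x`, `±y`, and consider all
vertices of maximal height in that direction. No point and no end of `η` sits there, and a multi
line can be met there only on its outward end. The ends of `Δ` that go outwards share one direction
`e`, which is not vertical, so none of them is an entry of a cross-ratio. Such an end is adjacent to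
a trivalent vertex: near a cone in which its vertex has valence at least four, the cross-ratio
functions do not notice the end and are linear, so the cone has weight zero
(`not_highValence_of_crossRatioWeight_ne_zero`, `card_flags_eq_three`). Hence the top vertices can
be moved consistently: those without an outward end by `e`, the others along their single descending
flag. This deformation is nonzero and respects all conditions, so it lies in the kernel of the
ev-matrix, which is impossible (`IsDeformation.eq_zero`, `height_lt`).

Over the box, a floor edge that changes `z` has length at most `2 * ε`. Directions and the number of
vertices are bounded by the degree and `n`, so two points on one floor have `z`-coordinates closer
than the stretching allows. -/

namespace TropCurve

/-! ### Cones of the moduli space of trees: cross-ratio weights and valence -/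

section Moduli

variable {I : Type*}

/-- Two sets are disjoint or nested. -/
def Laminar (A B : Finset I) : Prop := Disjoint A B ∨ A ⊆ B ∨ B ⊆ A

lemma Laminar.symm {A B : Finset I} (h : Laminar A B) : Laminar B A := by
  rcases h with h | h | h
  exacts [.inl h.symm, .inr (.inr h), .inr (.inl h)]

/-- The split `A` separates `p, q` from `s, t`. -/
def Splits (A : Finset I) (p q s t : I) : Prop :=
  (p ∈ A ∧ q ∈ A ∧ s ∉ A ∧ t ∉ A) ∨ (p ∉ A ∧ q ∉ A ∧ s ∈ A ∧ t ∈ A)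

lemma Splits.symm {A : Finset I} {p q s t : I} (h : Splits A p q s t) : Splits A s t p q := by
  rcases h with ⟨h1, h2, h3, h4⟩ | ⟨h1, h2, h3, h4⟩
  exacts [.inr ⟨h3, h4, h1, h2⟩, .inl ⟨h3, h4, h1, h2⟩]

/-- The linear form `D ↦ D p s + D q t - D p q - D s t` on distance vectors. -/
def crossForm (p q s t : I) : (I → I → ℝ) →ₗ[ℝ] ℝ where
  toFun D := D p s + D q t - D p q - D s t
  map_add' D E := by simp only [Pi.add_apply]; ring
  map_smul' c D := by simp only [Pi.smul_apply, smul_eq_mul, RingHom.id_apply]; ring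

variable [DecidableEq I]

/-- Each of the four labels occurs once with each sign, so the form descends to the quotient
containing the fan. -/
lemma crossForm_endShift {p q s t : I} (hps : p ≠ s) (hqt : q ≠ t) (hpq : p ≠ q) (hst : s ≠ t)
    (a : I → ℝ) : crossForm p q s t (endShift a) = 0 := by
  simp only [crossForm, endShift, LinearMap.coe_mk, AddHom.coe_mk, hps, hqt, hpq, hst, if_false]
  ring

-- The form takes the values `2`, `0`, `-2` on the splits `pq|st`, `pt|qs`, `ps|qt`. Half of it is
-- therefore the cross-ratio function wherever the third split is absent.
open scoped Classical in
lemma crossForm_splitVec {p q s t : I} {A : Finset I} (h : ¬ Splits A p s q t) :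
    crossForm p q s t (splitVec A) = 2 * if Splits A p q s t then 1 else 0 := by
  unfold Splits at *
  simp only [crossForm, splitVec, LinearMap.coe_mk, AddHom.coe_mk]
  by_cases h1 : p ∈ A <;> by_cases h2 : q ∈ A <;> by_cases h3 : s ∈ A <;> by_cases h4 : t ∈ A <;>
    simp [h1, h2, h3, h4] at h ⊢ <;> norm_num

variable [Fintype I]

/-- The part of the split `A` that does not contain the label `x`. -/
def away (x : I) (A : Finset I) : Finset I := if x ∈ A then Aᶜ else A

lemma mem_away {x y : I} {A : Finset I} : y ∈ away x A ↔ ¬(y ∈ A ↔ x ∈ A) := by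
  unfold away; split_ifs with h <;> simp [h]

lemma not_mem_away_self (x : I) (A : Finset I) : x ∉ away x A := by simp [mem_away]

lemma away_away {x y : I} {A : Finset I} (h : y ∉ A) : away y (away x A) = A := by
  ext z; simp only [mem_away]; tauto

lemma Laminar.away {A B : Finset I} (x : I) (h : Laminar A B) :
    Laminar (away x A) (away x B) := by
  unfold Laminar at *
  simp only [Finset.disjoint_left, Finset.subset_iff, mem_away] at *
  by_cases hA : x ∈ A <;> by_cases hB : x ∈ B <;> simp only [hA, hB, iff_true, iff_false, not_not]
  · rcases h with h | h | h
    · exact absurd hB (h hA)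
    · exact .inr (.inr fun a ha hb => ha (h hb))
    · exact .inr (.inl fun a ha hb => ha (h hb))
  · rcases h with h | h | h
    · exact .inr (.inr fun a ha hb => h hb ha)
    · exact absurd (h hA) hB
    · exact .inl fun a ha hb => ha (h hb)
  · rcases h with h | h | h
    · exact .inr (.inl fun a ha hb => h ha hb)
    · exact .inl fun a ha => h ha
    · exact absurd (h hB) hA
  · exact h

lemma IsCone.laminar_away {r : I} {τ : Finset (Finset I)} (h : IsCone r τ) (x : I)
    {A B : Finset I} (hA : A ∈ τ) (hB : B ∈ τ) : Laminar (away x A) (away x B) :=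
  Laminar.away x (h.2 A hA B hB)

lemma splits_away {A : Finset I} {x p q s t : I} :
    Splits (away x A) p q s t ↔ Splits A p q s t := by
  unfold away Splits
  split_ifs
  · simp only [Finset.mem_compl, not_not]; exact or_comm
  · rfl

/-- In the trees of the cone `τ`, the vertex of the end `x` has valence at least four: there are
three other labels no two of which are separated from `x` by the same edge. -/
def HighValence (x : I) (τ : Finset (Finset I)) : Prop :=
  ∃ Y : Finset I, 3 ≤ Y.card ∧ x ∉ Y ∧
    ∀ A ∈ τ, ∀ y ∈ Y, ∀ z ∈ Y, y ∈ away x A → z ∈ away x A → y = z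

/-- A vertex of valence at least four can be resolved: a new edge pulling `a` and `b` away from `x`
and `c` is compatible with `τ`, against maximality. -/
lemma not_highValence_of_isFacet {r : I} {τ : Finset (Finset I)} (h : IsFacet r τ) (x : I) :
    ¬ HighValence x τ := by
  rintro ⟨Y, hY, hxY, hsep⟩
  obtain ⟨a, b, c, ha, hb, hc, hab, hac, hbc⟩ := Finset.two_lt_card_iff.1 hY
  -- `F` collects `a`, `b` and everything behind an edge that separates one of them from `x`; this
  -- saturation makes it compatible with all of `τ`.
  set F : Finset I := Finset.univ.filter fun z =>
    z = a ∨ z = b ∨ ∃ B ∈ τ, (a ∈ away x B ∨ b ∈ away x B) ∧ z ∈ away x B with hF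
  have haF : a ∈ F := by simp [hF]
  have hbF : b ∈ F := by simp [hF]
  have hxF : x ∉ F := by
    simp only [hF, Finset.mem_filter, Finset.mem_univ, true_and, not_or, not_exists, not_and]
    exact ⟨fun h => hxY (h ▸ ha), fun h => hxY (h ▸ hb),
      fun B _ _ => not_mem_away_self x B⟩
  have hcF : c ∉ F := by
    simp only [hF, Finset.mem_filter, Finset.mem_univ, true_and, not_or, not_exists, not_and]
    refine ⟨Ne.symm hac, Ne.symm hbc, fun B hB hab' hcB => ?_⟩
    rcases hab' with h' | h'
    · exact hac (hsep B hB a ha c hc h' hcB)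
    · exact hbc (hsep B hB b hb c hc h' hcB)
  have hlam : ∀ B ∈ τ, Laminar F (away x B) := by
    intro B hB
    by_cases hd : Disjoint F (away x B)
    · exact .inl hd
    refine .inr (.inr fun w hw => ?_)
    obtain ⟨z, hzF, hzB⟩ := Finset.not_disjoint_iff.1 hd
    simp only [hF, Finset.mem_filter, Finset.mem_univ, true_and] at hzF ⊢
    rcases hzF with rfl | rfl | ⟨D, hD, habD, hzD⟩
    · exact .inr (.inr ⟨B, hB, .inl hzB, hw⟩)
    · exact .inr (.inr ⟨B, hB, .inr hzB, hw⟩)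
    · rcases h.1.laminar_away x hB hD with h' | h' | h'
      · exact absurd hzD (Finset.disjoint_left.1 h' hzB)
      · exact .inr (.inr ⟨D, hD, habD, h' hw⟩)
      · exact .inr (.inr ⟨B, hB, habD.imp (fun q => h' q) (fun q => h' q), hw⟩)
  have hF2 : 2 ≤ F.card := Finset.one_lt_card.2 ⟨a, haF, b, hbF, hab⟩
  have hFc2 : 2 ≤ Fᶜ.card := Finset.one_lt_card.2
    ⟨x, by simpa using hxF, c, by simpa using hcF, fun h => hxY (h ▸ hc)⟩
  have hnew : IsCone r (insert (away r F) τ) := by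
    have key : ∀ B ∈ τ, Laminar (away r F) B := fun B hB => by
      have := (hlam B hB).away r
      rwa [away_away (h.1.1 B hB).1] at this
    refine ⟨fun A hA => ?_, fun A hA B hB => ?_⟩
    · rcases Finset.mem_insert.1 hA with rfl | hA
      · refine ⟨not_mem_away_self r F, ?_⟩
        unfold away
        split_ifs
        · exact ⟨hFc2, by simpa using hF2⟩
        · exact ⟨hF2, hFc2⟩
      · exact h.1.1 A hA
    · rcases Finset.mem_insert.1 hA with rfl | hA <;> rcases Finset.mem_insert.1 hB with rfl | hB
      · exact .inr (.inl subset_rfl)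
      · exact key B hB
      · exact (key A hA).symm
      · exact h.1.2 A hA B hB
  have hmem : away r F ∈ τ := by
    have := h.2 _ hnew (Finset.subset_insert _ _)
    rw [← this]; exact Finset.mem_insert_self _ _
  have := hsep _ hmem a ha b hb
  rw [away_away hxF] at this
  exact hab (this haF hbF)

/-- If the vertex of `x` has valence at least four in `τ`, but not any more after the new edge `A`
has been introduced, then `A` becomes an edge of `τ` if `x` is forgotten. -/
lemma exists_splits_of_not_highValence_insert {r x : I} {τ : Finset (Finset I)} {A : Finset I}
    (hx : HighValence x τ) (hcone : IsCone r (insert A τ)) (hA : ¬ HighValence x (insert A τ))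
    {p q s t : I} (hp : x ≠ p) (hq : x ≠ q) (hs : x ≠ s) (ht : x ≠ t) (hpq : p ≠ q) (hst : s ≠ t)
    (hsplit : Splits A p q s t) : ∃ B ∈ τ, Splits B p q s t := by
  wlog h : p ∈ away x A ∧ q ∈ away x A ∧ s ∉ away x A ∧ t ∉ away x A
    generalizing p q s t with hwlog
  · obtain ⟨B, hB, hB'⟩ := hwlog hs ht hp hq hst hpq hsplit.symm <|
      (splits_away.2 hsplit.symm).resolve_right fun h' => h ⟨h'.2.2.1, h'.2.2.2, h'.1, h'.2.1⟩
    exact ⟨B, hB, hB'.symm⟩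
  obtain ⟨hpA, hqA, hsA, htA⟩ := h
  obtain ⟨Y, hY, hxY, hsep⟩ := hx
  have hlam : ∀ B ∈ τ, Laminar (away x B) (away x A) := fun B hB =>
    hcone.laminar_away x (Finset.mem_insert_of_mem hB) (Finset.mem_insert_self _ _)
  -- The witness `Y` for `τ` must fail after `A` is added, and only `A` can be responsible.
  have htwo : ∃ y ∈ Y, ∃ z ∈ Y, y ∈ away x A ∧ z ∈ away x A ∧ y ≠ z := by
    by_contra! hcon
    refine hA ⟨Y, hY, hxY, fun B hB y hy z hz h1 h2 => ?_⟩
    rcases Finset.mem_insert.1 hB with rfl | hB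
    · exact hcon y hy z hz h1 h2
    · exact hsep B hB y hy z hz h1 h2
  obtain ⟨y, hy, z, hz, hyA, hzA, hyz⟩ := htwo
  have hnot : ∀ B ∈ τ, ¬ away x A ⊆ away x B := fun B hB hsub =>
    hyz (hsep B hB y hy z hz (hsub hyA) (hsub hzA))
  have hyB : ∀ B ∈ τ, ∀ w, w ∉ away x A → y ∈ away x B → w ∉ away x B := by
    intro B hB w hw hyB hwB
    rcases hlam B hB with h' | h' | h'
    · exact Finset.disjoint_left.1 h' hyB hyA
    · exact hw (h' hwB)
    · exact hnot B hB h'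
  -- Otherwise `y`, `s`, `t` would witness high valence even after `A` is added.
  have hex : ∃ B ∈ τ, s ∈ away x B ∧ t ∈ away x B := by
    by_contra! hcon
    have hys : y ≠ s := fun h => hsA (h ▸ hyA)
    have hyt : y ≠ t := fun h => htA (h ▸ hyA)
    refine hA ⟨{y, s, t}, ?_, ?_, ?_⟩
    · rw [Finset.card_eq_three.2 ⟨y, s, t, hys, hyt, hst, rfl⟩]
    · simp only [Finset.mem_insert, Finset.mem_singleton, not_or]
      exact ⟨fun h => hxY (h ▸ hy), hs, ht⟩
    · intro B hB
      simp only [Finset.mem_insert, Finset.mem_singleton]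
      rcases Finset.mem_insert.1 hB with rfl | hB
      · rintro a (rfl | rfl | rfl) b (rfl | rfl | rfl) h4 h5 <;> first | rfl | contradiction
      · have h1 := hyB B hB s hsA
        have h2 := hyB B hB t htA
        have h3 := hcon B hB
        rintro a (rfl | rfl | rfl) b (rfl | rfl | rfl) h4 h5 <;>
          first | rfl | exact absurd h5 (h1 h4) | exact absurd h4 (h1 h5) |
            exact absurd h5 (h2 h4) | exact absurd h4 (h2 h5) | exact absurd h5 (h3 h4) |
            exact absurd h4 (h3 h5)
  obtain ⟨B, hB, hsB, htB⟩ := hex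
  have hdisj : Disjoint (away x B) (away x A) := by
    rcases hlam B hB with h' | h' | h'
    · exact h'
    · exact absurd (h' hsB) hsA
    · exact absurd h' (hnot B hB)
  exact ⟨B, hB, splits_away.1 <|
    .inr ⟨Finset.disjoint_right.1 hdisj hpA, Finset.disjoint_right.1 hdisj hqA, hsB, htB⟩⟩

/-- Applying `m` to the balancing relation evaluates both sums in the weight at once, whichever
coefficients were chosen. Neighbouring cones of weight zero may be ignored. -/
lemma divisorWeight_eq_zero_of_linear {r : I} {φ : Finset I → ℝ} {W : Finset (Finset I) → ℝ}
    {τ : Finset (Finset I)} (m : (I → I → ℝ) →ₗ[ℝ] ℝ) (hm : ∀ a, m (endShift a) = 0)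
    (hnew : ∀ A ∈ newRays r τ, W (insert A τ) ≠ 0 → m (splitVec A) = φ A)
    (hold : ∀ B ∈ τ, m (splitVec B) = φ B) : divisorWeight r φ W τ = 0 := by
  classical
  unfold divisorWeight
  split_ifs with h
  · obtain ⟨a, ha⟩ := h.2.choose_spec
    have h1 := congrArg m ha
    rw [map_sum, map_add, hm, add_zero, map_sum] at h1
    simp only [map_smul, smul_eq_mul] at h1
    rw [sub_eq_zero]
    calc _ = ∑ A ∈ newRays r τ, W (insert A τ) * m (splitVec A) := by
          refine Finset.sum_congr rfl fun A hA => ?_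
          by_cases h0 : W (insert A τ) = 0
          · simp [h0]
          · rw [hnew A hA h0]
      _ = _ := by
        rw [h1]
        exact Finset.sum_congr rfl fun B hB => by rw [hold B hB]
  · rfl

/-- Compatible splits cannot resolve the same four labels in two different ways. -/
lemma IsCone.not_splits {r : I} {τ : Finset (Finset I)} (h : IsCone r τ) {p q s t : I}
    {A B : Finset I} (hA : A ∈ τ) (hB : B ∈ τ) (h1 : Splits A p s q t) : ¬ Splits B p t s q := by
  have := h.2 A hA B hB
  simp only [Splits, Finset.disjoint_left, Finset.subset_iff] at *
  rcases this with h2 | h2 | h2 <;>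
    have hp := @h2 p <;> have hq := @h2 q <;> have hs := @h2 s <;> have ht := @h2 t <;> tauto

open scoped Classical in
/-- An end that is not an entry of a cross-ratio is adjacent to a trivalent vertex. -/
theorem not_highValence_of_crossRatioWeight_ne_zero {r x : I} (bs : List (Fin 4 ↪ I))
    (hbs : ∀ b ∈ bs, ∀ i, b i ≠ x) (τ : Finset (Finset I))
    (hτ : crossRatioWeight r bs τ ≠ 0) : ¬ HighValence x τ := by
  induction bs generalizing τ with
  | nil =>
    refine not_highValence_of_isFacet (r := r) ?_ x
    by_contra h
    simp [crossRatioWeight, h] at hτ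
  | cons b bs ih =>
    intro hx
    have ih' := ih fun b hb => hbs b (List.mem_cons_of_mem _ hb)
    have hb : ∀ i, x ≠ b i := fun i => (hbs b List.mem_cons_self i).symm
    have hne : ∀ i j, i ≠ j → b i ≠ b j := fun i j hij => b.injective.ne hij
    have hcone : IsCone r τ := by
      by_contra hc
      refine hτ ?_
      simp [crossRatioWeight, divisorWeight, hc]
    have hφ : ∀ A, crossRatioFun b A = if Splits A (b 0) (b 1) (b 2) (b 3) then 1 else 0 := by
      intro A; unfold crossRatioFun Splits; congr
    have hφ' : ∀ A, crossRatioFun b A = if Splits A (b 0) (b 1) (b 3) (b 2) then 1 else 0 := by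
      intro A; rw [hφ]; congr 1; simp only [Splits, eq_iff_iff]; tauto
    -- By induction a neighbour of nonzero weight resolves the vertex of `x`. As `x` is not an entry
    -- of `b`, this produces no split of the four entries that `τ` lacks.
    have hnew : ∀ A ∈ newRays r τ, crossRatioWeight r bs (insert A τ) ≠ 0 →
        ∀ p q s t : Fin 4, p ≠ q → s ≠ t → Splits A (b p) (b q) (b s) (b t) →
        ∃ B ∈ τ, Splits B (b p) (b q) (b s) (b t) := by
      intro A hA hW p q s t hpq hst hS
      simp only [newRays, Finset.mem_filter] at hA
      exact exists_splits_of_not_highValence_insert (r := r) hx (by convert hA.2.2)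
        (ih' _ (by convert hW)) (hb p) (hb q) (hb s) (hb t) (hne _ _ hpq) (hne _ _ hst) hS
    refine hτ ?_
    -- At most one of the splits `02|13` and `03|12` occurs in `τ`. The linear form is chosen so
    -- that the split on which it differs from the function is one that is missing.
    by_cases hS : ∃ B ∈ τ, Splits B (b 0) (b 2) (b 1) (b 3)
    · obtain ⟨A, hA, hSA⟩ := hS
      have hno : ∀ B ∈ τ, ¬ Splits B (b 0) (b 3) (b 1) (b 2) := by
        intro B hB h
        refine hcone.not_splits hA hB hSA ?_
        unfold Splits at *; tauto
      refine divisorWeight_eq_zero_of_linear ((1 / 2 : ℝ) • crossForm (b 0) (b 1) (b 3) (b 2))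
        (fun a => ?_) (fun A hA hW => ?_) fun B hB => ?_
      · rw [LinearMap.smul_apply, crossForm_endShift (hne _ _ (by decide)) (hne _ _ (by decide))
          (hne _ _ (by decide)) (hne _ _ (by decide)), smul_zero]
      · rw [LinearMap.smul_apply, crossForm_splitVec, hφ', smul_eq_mul]
        · ring
        · intro h
          obtain ⟨B, hB, hB'⟩ := hnew A hA (by convert hW) 0 3 1 2 (by decide) (by decide) h
          exact hno B hB hB'
      · rw [LinearMap.smul_apply, crossForm_splitVec (hno B hB), hφ', smul_eq_mul]
        ring
    · push Not at hS
      refine divisorWeight_eq_zero_of_linear ((1 / 2 : ℝ) • crossForm (b 0) (b 1) (b 2) (b 3))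
        (fun a => ?_) (fun A hA hW => ?_) fun B hB => ?_
      · rw [LinearMap.smul_apply, crossForm_endShift (hne _ _ (by decide)) (hne _ _ (by decide))
          (hne _ _ (by decide)) (hne _ _ (by decide)), smul_zero]
      · rw [LinearMap.smul_apply, crossForm_splitVec, hφ, smul_eq_mul]
        · ring
        · intro h
          obtain ⟨B, hB, hB'⟩ := hnew A hA (by convert hW) 0 2 1 3 (by decide) (by decide) h
          exact hS B hB hB'
      · rw [LinearMap.smul_apply, crossForm_splitVec (hS B hB), hφ, smul_eq_mul]
        ring

end Moduli

end TropCurve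

namespace TropCurve

namespace StableMap

variable {n k : ℕ} {Δ : Fin k → Fin 3 → ℤ} {V : Type*} [Fintype V]

/-! ### Paths and flags -/

lemma path_isPath (C : StableMap n Δ V) (u w : V) : (C.path u w).IsPath :=
  (C.isTree.existsUnique_path u w).choose_spec.1

lemma eq_path (C : StableMap n Δ V) {u w : V} {p : C.graph.Walk u w} (hp : p.IsPath) :
    p = C.path u w :=
  (C.isTree.existsUnique_path u w).unique hp (C.path_isPath u w)

lemma path_not_nil (C : StableMap n Δ V) {u w : V} (h : w ≠ u) : ¬ (C.path u w).Nil :=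
  fun hn => h hn.eq.symm

open scoped Classical in
/-- The flags at the vertex `v`: bounded edges, given by their other vertex, and ends. -/
noncomputable def flags (C : StableMap n Δ V) (v : V) : Finset (V ⊕ Label n k) :=
  (Finset.univ.filter fun w => C.graph.Adj v w).disjSum
    (Finset.univ.filter fun x => C.attach x = v)

lemma inl_mem_flags {C : StableMap n Δ V} {v w : V} :
    Sum.inl w ∈ C.flags v ↔ C.graph.Adj v w := by
  simp [flags]

lemma inr_mem_flags {C : StableMap n Δ V} {v : V} {x : Label n k} :
    Sum.inr x ∈ C.flags v ↔ C.attach x = v := by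
  simp [flags]

lemma three_le_card_flags (C : StableMap n Δ V) (v : V) : 3 ≤ (C.flags v).card := by
  rw [flags, Finset.card_disjSum]
  exact C.three_le_valence v

/-- The direction vector of a flag at `v`, pointing away from `v`. -/
def flagDir (C : StableMap n Δ V) (v : V) : V ⊕ Label n k → Fin 3 → ℤ :=
  Sum.elim (C.dir v) (endDir Δ)

lemma sum_flagDir (C : StableMap n Δ V) (v : V) : ∑ f ∈ C.flags v, C.flagDir v f = 0 := by
  rw [flags, Finset.sum_disjSum]
  exact C.balanced v

/-- Each branch of the tree at a vertex contains an end. -/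
lemma exists_end_of_adj (C : StableMap n Δ V) {v w : V} (h : C.graph.Adj v w) :
    ∃ y, C.attach y ≠ v ∧ (C.path v (C.attach y)).snd = w := by
  classical
  set Q : Finset V := Finset.univ.filter fun q => q ≠ v ∧ (C.path v q).snd = w with hQ
  have hwQ : w ∈ Q := by
    simp only [hQ, Finset.mem_filter, Finset.mem_univ, true_and]
    refine ⟨h.ne', ?_⟩
    rw [← C.eq_path (p := h.toWalk) (by simpa using h.ne)]
    simp
  -- A vertex of the branch farthest from `v` has no further neighbour, so its valence forces an
  -- end.
  obtain ⟨q, hq, hmax⟩ := Q.exists_max_image (fun q => (C.path v q).length) ⟨w, hwQ⟩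
  simp only [hQ, Finset.mem_filter, Finset.mem_univ, true_and] at hq
  by_contra! hcon
  have hnone : (Finset.univ.filter fun x => C.attach x = q).card = 0 := by
    rw [Finset.card_eq_zero, Finset.filter_eq_empty_iff]
    rintro x - rfl
    exact hcon x hq.1 hq.2
  have hcard := C.three_le_valence q
  have hlt : 1 < (Finset.univ.filter fun z => C.graph.Adj q z).card := by
    have : (Finset.univ.filter fun z => C.graph.Adj q z).card + 0 ≥ 3 := by
      rw [← hnone]; convert hcard
    omega
  obtain ⟨z, hz, hzne⟩ := Finset.exists_mem_ne hlt (C.path v q).penultimate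
  simp only [Finset.mem_filter, Finset.mem_univ, true_and] at hz
  have hsupp : z ∉ (C.path v q).support := fun hs =>
    hzne (C.isTree.isAcyclic.eq_penultimate_of_adj_end (C.path_isPath v q) hz hs)
  have hpath := C.eq_path ((C.path_isPath v q).concat hsupp hz)
  have hzQ : z ∈ Q := by
    simp only [hQ, Finset.mem_filter, Finset.mem_univ, true_and]
    refine ⟨fun h => hsupp (h ▸ SimpleGraph.Walk.start_mem_support _), ?_⟩
    rw [← hpath, ← hq.2]
    have hnn := C.path_not_nil hq.1
    revert hnn
    generalize C.path v q = p
    intro hnn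
    cases p with
    | nil => simp at hnn
    | cons h p => simp [SimpleGraph.Walk.concat_cons]
  have := hmax z hzQ
  rw [← hpath, SimpleGraph.Walk.length_concat] at this
  omega

/-- Different branches of the tree at `v` have no other vertices in common. -/
lemma snd_path_eq_of_mem_support (C : StableMap n Δ V) {v q q' a : V} (ha : a ≠ v)
    (h : a ∈ (C.path v q).support) (h' : a ∈ (C.path v q').support) :
    (C.path v q).snd = (C.path v q').snd := by
  classical
  rw [← SimpleGraph.Walk.snd_takeUntil ha _ h, ← SimpleGraph.Walk.snd_takeUntil ha _ h',
    C.eq_path ((C.path_isPath v q).takeUntil h), C.eq_path ((C.path_isPath v q').takeUntil h')]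

/-- An edge that separates the end `y` from the end `x` lies on the path between them. -/
lemma edge_mem_path_of_mem_away (C : StableMap n Δ V) {x y : Label n k} {u w : V}
    (h : y ∈ away x (C.side u w)) :
    s(u, w) ∈ (C.path (C.attach x) (C.attach y)).edges := by
  by_contra hcon
  rw [mem_away] at h
  refine h ?_
  have hr : (C.graph.deleteEdges {s(u, w)}).Reachable (C.attach x) (C.attach y) :=
    ⟨(C.path (C.attach x) (C.attach y)).toDeleteEdge s(u, w) hcon⟩
  simp only [side, Finset.mem_filter, Finset.mem_univ, true_and]
  exact ⟨fun h => h.trans hr.symm, fun h => h.trans hr⟩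

/-- One end is chosen behind each flag other than `x`. An edge separating such an end from `x` lies
on the path to it and hence in its branch, so no edge serves two branches. -/
theorem highValence_cone (C : StableMap n Δ V) (r x : Label n k)
    (h : 4 ≤ (C.flags (C.attach x)).card) : HighValence x (C.cone r) := by
  classical
  set v := C.attach x with hv
  have hex : ∀ f : V ⊕ Label n k, ∃ y : Label n k, f ∈ C.flags v →
      (∀ w, f = Sum.inl w → C.attach y ≠ v ∧ (C.path v (C.attach y)).snd = w) ∧
      ∀ z, f = Sum.inr z → y = z := by
    rintro (w | z)
    · by_cases hw : C.graph.Adj v w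
      · obtain ⟨y, hy⟩ := C.exists_end_of_adj hw
        refine ⟨y, fun _ => ⟨?_, by simp⟩⟩
        rintro w' ⟨⟩; exact hy
      · exact ⟨x, fun h => absurd (inl_mem_flags.1 h) hw⟩
    · exact ⟨z, by simp⟩
  choose Y hY using hex
  -- a label separated from `x` by an edge belongs to the first edge of its path
  have hsep : ∀ f ∈ C.flags v, ∀ u w, Y f ∈ away x (C.side u w) →
      f = Sum.inl (C.path v (C.attach (Y f))).snd ∧
        s(u, w) ∈ (C.path v (C.attach (Y f))).edges := by
    intro f hf u w hm
    have hedge := C.edge_mem_path_of_mem_away hm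
    rw [← hv] at hedge
    refine ⟨?_, hedge⟩
    rcases f with w' | z
    · rw [((hY _ hf).1 w' rfl).2]
    · have h1 := (hY _ hf).2 z rfl
      have h2 := inr_mem_flags.1 hf
      rw [h1, h2, ← C.eq_path SimpleGraph.Walk.IsPath.nil] at hedge
      simp at hedge
  have hinj : Set.InjOn Y (C.flags v) := by
    rintro (w | z) hf (w' | z') hf' heq
    · rw [← ((hY _ hf).1 w rfl).2, ← ((hY _ hf').1 w' rfl).2, heq]
    · have h1 := ((hY _ hf).1 w rfl).1
      rw [heq, (hY _ hf').2 z' rfl] at h1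
      exact absurd (inr_mem_flags.1 hf') h1
    · have h1 := ((hY _ hf').1 w' rfl).1
      rw [← heq, (hY _ hf).2 z rfl] at h1
      exact absurd (inr_mem_flags.1 hf) h1
    · rw [← (hY _ hf).2 z rfl, ← (hY _ hf').2 z' rfl, heq]
  have hxf : Sum.inr x ∈ C.flags v := inr_mem_flags.2 rfl
  refine ⟨((C.flags v).erase (Sum.inr x)).image Y, ?_, ?_, ?_⟩
  · rw [Finset.card_image_of_injOn (hinj.mono (by simp)), Finset.card_erase_of_mem hxf]
    omega
  · intro hx
    obtain ⟨f, hf, hfx⟩ := Finset.mem_image.1 hx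
    rw [Finset.mem_erase] at hf
    exact hf.1 (hinj hf.2 hxf (hfx.trans ((hY _ hxf).2 x rfl).symm))
  · intro A hA y hy z hz hyA hzA
    obtain ⟨f, hf, rfl⟩ := Finset.mem_image.1 hy
    obtain ⟨g, hg, rfl⟩ := Finset.mem_image.1 hz
    simp only [cone, Finset.mem_filter, Finset.mem_univ, true_and] at hA
    obtain ⟨-, u, w, huw, rfl⟩ := hA
    obtain ⟨h1, h2⟩ := hsep f (Finset.mem_of_mem_erase hf) u w hyA
    obtain ⟨h3, h4⟩ := hsep g (Finset.mem_of_mem_erase hg) u w hzA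
    have : (C.path v (C.attach (Y f))).snd = (C.path v (C.attach (Y g))).snd := by
      by_cases hu : u = v
      · exact C.snd_path_eq_of_mem_support (a := w) (fun h => huw.ne (hu.trans h.symm))
          (SimpleGraph.Walk.snd_mem_support_of_mem_edges _ h2)
          (SimpleGraph.Walk.snd_mem_support_of_mem_edges _ h4)
      · exact C.snd_path_eq_of_mem_support hu
          (SimpleGraph.Walk.fst_mem_support_of_mem_edges _ h2)
          (SimpleGraph.Walk.fst_mem_support_of_mem_edges _ h4)
    rw [h1, h3, this]

/-- In a contributing stable map, an end that is not an entry of a cross-ratio is adjacent to a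
trivalent vertex. -/
theorem card_flags_eq_three (C : StableMap n Δ V) {S : Conditions n Δ} {r x : Label n k}
    {ρ : Fin k → Fin 3} (hmult : C.mult S r ρ ≠ 0) (hx : ∀ j t, S.cr j t ≠ x) :
    (C.flags (C.attach x)).card = 3 := by
  by_contra h
  have h4 : 4 ≤ (C.flags (C.attach x)).card := by
    have := C.three_le_card_flags (C.attach x); omega
  refine not_highValence_of_crossRatioWeight_ne_zero (List.ofFn S.cr) ?_ _
    (left_ne_zero_of_mul hmult) (C.highValence_cone r x h4)
  intro b hb t
  obtain ⟨j, rfl⟩ := List.mem_ofFn.1 hb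
  exact hx j t

/-! ### Infinitesimal deformations -/

/-- Reversing a bounded edge changes the sign of its direction vector. -/
lemma dir_symm (C : StableMap n Δ V) {u w : V} (h : C.graph.Adj u w) :
    C.dir w u = - C.dir u w := by
  funext t
  have h1 := C.affine u w h t
  have h2 := C.affine w u h.symm t
  have hl := C.length_pos s(u, w) h
  rw [Sym2.eq_swap] at h2
  have h3 : C.length s(u, w) * ((C.dir u w t : ℝ) + C.dir w u t) = 0 := by linarith
  have h4 := (mul_eq_zero.1 h3).resolve_left hl.ne'
  have h5 : C.dir u w t + C.dir w u t = 0 := by exact_mod_cast h4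
  simp only [Pi.neg_apply]
  omega

/-- `s` are the velocities of the vertices of an infinitesimal deformation of `C` that changes the
length of the bounded edge `e` with the rate `m e`. -/
def IsDeformation (C : StableMap n Δ V) (s : V → Fin 3 → ℝ) (m : Sym2 V → ℝ) : Prop :=
  ∀ u w, C.graph.Adj u w → ∀ t, s w t = s u t + m s(u, w) * C.dir u w t

/-- The vector of a deformation in the coordinates of the cell. -/
def deformVec (C : StableMap n Δ V) (r : Label n k) (s : V → Fin 3 → ℝ) (m : Sym2 V → ℝ) :
    C.Coord → ℝ :=
  Sum.elim (s (C.attach r)) fun e => m e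

lemma IsDeformation.walk {C : StableMap n Δ V} {s : V → Fin 3 → ℝ} {m : Sym2 V → ℝ}
    (h : C.IsDeformation s m) {u w : V} (p : C.graph.Walk u w) (t : Fin 3) :
    s w t = s u t + (p.darts.map fun a => m a.edge * C.dir a.fst a.snd t).sum := by
  induction p with
  | nil => simp
  | cons hadj p ih =>
    rw [ih, h _ _ hadj t]
    simp only [SimpleGraph.Walk.darts_cons, List.map_cons, List.sum_cons,
      SimpleGraph.Dart.edge_mk]
    ring

open scoped Classical in
lemma sum_edge_coeff (C : StableMap n Δ V) (m : Sym2 V → ℝ) (t : Fin 3)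
    (l : List C.graph.Dart) :
    ∑ e : C.graph.edgeSet,
      (((l.map fun a => if a.edge = (e : Sym2 V) then C.dir a.fst a.snd t else 0).sum : ℤ) : ℝ)
        * m e = (l.map fun a => m a.edge * C.dir a.fst a.snd t).sum := by
  induction l with
  | nil => simp
  | cons a l ih =>
    simp only [List.map_cons, List.sum_cons, Int.cast_add, add_mul, Finset.sum_add_distrib, ih]
    congr 1
    rw [Finset.sum_eq_single ⟨a.edge, a.edge_mem⟩]
    · simp [mul_comm]
    · rintro e - he
      rw [if_neg (fun h => he (Subtype.ext h.symm))]
      simp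
    · simp

-- Applying the ev-matrix to a deformation amounts to summing its edge contributions along the path
-- from the base, which gives the velocity at the end.
open scoped Classical in
lemma IsDeformation.sum_evCoeff {C : StableMap n Δ V} {s : V → Fin 3 → ℝ} {m : Sym2 V → ℝ}
    (h : C.IsDeformation s m) (r x : Label n k) (t : Fin 3) :
    ∑ y, (C.evCoeff r x t y : ℝ) * C.deformVec r s m y = s (C.attach x) t := by
  rw [h.walk (C.path (C.attach r) (C.attach x)) t, ← C.sum_edge_coeff, Fintype.sum_sum_type]
  congr 1
  simp [evCoeff, deformVec]

/-- A stable map with a nonzero ev-multiplicity has no deformations that respect the conditions. -/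
theorem IsDeformation.eq_zero {C : StableMap n Δ V} {s : V → Fin 3 → ℝ} {m : Sym2 V → ℝ}
    (h : C.IsDeformation s m) {S : Conditions n Δ} {r : Label n k} {ρ : Fin k → Fin 3}
    (hmult : C.evMult S r ρ ≠ 0) (hp : ∀ i, s (C.attach (Sum.inl i)) = 0)
    (hη : ∀ f ∈ S.η, s (C.attach (Sum.inr f)) = 0)
    (hκ : ∀ f ∈ S.κ, ∑ i : Fin 2, (normalForm (ρ f) i : ℝ) *
      s (C.attach (Sum.inr f)) i.castSucc = 0) : s = 0 := by
  classical
  unfold evMult at hmult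
  -- `evMult` is zero for a matrix that is not square, so only the square case survives.
  split_ifs at hmult with hne
  · set g := hne.some with hg
    have hmv : ((C.evMatrix S r ρ).submatrix id g).mulVec (C.deformVec r s m ∘ g) = 0 := by
      rw [Matrix.submatrix_mulVec_equiv]
      funext y
      simp only [Function.comp_apply, Function.comp_def, id, Equiv.apply_symm_apply]
      rcases y with ⟨i, t⟩ | ⟨f, t⟩ | f
      · have := h.sum_evCoeff r (Sum.inl i) t
        rw [hp] at this
        exact this
      · have := h.sum_evCoeff r (Sum.inr f) t.castSucc
        rw [hη f f.2] at this
        exact this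
      · have : ∀ i : Fin 2, _ := fun i => h.sum_evCoeff r (Sum.inr f) i.castSucc
        have hk := hκ f f.2
        simp only [← this] at hk
        simp only [Matrix.mulVec, dotProduct, evMatrix, Matrix.of_apply, Sum.elim_inr]
        calc _ = ((S.L f).weight : ℝ) * ∑ i : Fin 2, (normalForm (ρ f) i : ℝ) *
              ∑ y, (C.evCoeff r (Sum.inr f) i.castSucc y : ℝ) * C.deformVec r s m y := by
              simp only [Finset.mul_sum, Finset.sum_mul]
              rw [Finset.sum_comm]
              refine Finset.sum_congr rfl fun _ _ => Finset.sum_congr rfl fun _ _ => ?_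
              ring
          _ = 0 := by rw [hk, mul_zero]
    have hdet : ((C.evMatrix S r ρ).submatrix id g).det ≠ 0 := by
      simpa using hmult
    have hv := Matrix.eq_zero_of_mulVec_eq_zero hdet hmv
    have hz : ∀ y, C.deformVec r s m y = 0 := fun y => by
      have := congrFun hv (g.symm y)
      simpa using this
    funext w t
    rw [h.walk (C.path (C.attach r) w) t]
    have h0 : s (C.attach r) t = 0 := hz (Sum.inl t)
    have h1 : ∀ a : C.graph.Dart, m a.edge = 0 := fun a => hz (Sum.inr ⟨a.edge, a.edge_mem⟩)
    simp [h0, h1]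
  · exact absurd rfl hmult

end StableMap

end TropCurve

/-! ### Vertices of maximal height -/

namespace TropCurve

/-- Balancing at a trivalent vertex with a flag of height one: there is at most one flag of
negative height. -/
lemma trivalent_sum_neg {F : Type*} {s : Finset F} {D : F → Fin 3 → ℤ}
    (ψ : (Fin 3 → ℤ) →+ ℤ) {e : Fin 3 → ℤ} (he : ψ e = 1) (hcard : s.card = 3)
    (hsum : ∑ f ∈ s, D f = 0) {x : F} (hx : x ∈ s) (hxe : D x = e)
    {f : F} (hf : f ∈ s) :
    (ψ (D f) < 0 → ∑ g ∈ s with ψ (D g) < 0, D g = D f) ∧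
    (ψ (D f) = 0 → ∑ g ∈ s with ψ (D g) < 0, D g = - (e + D f)) := by
  classical
  by_cases hfx : f = x
  · subst hfx
    rw [hxe, he]
    exact ⟨fun h => by omega, fun h => by omega⟩
  have h1 : ((s.erase x).erase f).card = 1 := by
    rw [Finset.card_erase_of_mem (Finset.mem_erase.2 ⟨hfx, hf⟩), Finset.card_erase_of_mem hx, hcard]
  obtain ⟨g, hg⟩ := Finset.card_eq_one.1 h1
  have hgs : g ∈ (s.erase x).erase f := by rw [hg]; exact Finset.mem_singleton_self g
  simp only [Finset.mem_erase] at hgs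
  obtain ⟨hgf, hgx, hgs⟩ := hgs
  have hs : s = {x, f, g} := by
    rw [← hg, Finset.insert_erase (Finset.mem_erase.2 ⟨hfx, hf⟩), Finset.insert_erase hx]
  have hsum' : e + D f + D g = 0 := by
    rw [hs, Finset.sum_insert (by simp [Ne.symm hfx, Ne.symm hgx]),
      Finset.sum_insert (by simp [Ne.symm hgf]), Finset.sum_singleton, hxe] at hsum
    rw [← hsum, add_assoc]
  -- The other two heights are integers with sum `-1`, so they cannot both be negative.
  have hψ : 1 + ψ (D f) + ψ (D g) = 0 := by
    rw [← he, ← map_add, ← map_add, hsum', map_zero]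
  have hx0 : ¬ ψ (D x) < 0 := by rw [hxe, he]; omega
  rw [hs, Finset.filter_insert, if_neg hx0, Finset.filter_insert, Finset.filter_singleton]
  constructor
  · intro hneg
    have hg0 : ¬ ψ (D g) < 0 := by omega
    rw [if_pos hneg, if_neg hg0]
    simp
  · intro h0
    have hg0 : ψ (D g) < 0 := by omega
    rw [if_neg (by omega), if_pos hg0, Finset.sum_singleton]
    exact (neg_eq_of_add_eq_zero_right hsum').symm

namespace StableMap

variable {n k : ℕ} {Δ : Fin k → Fin 3 → ℤ} {V : Type*} [Fintype V]

/-- A coordinate `c` of the plane with a sign `σ`, and the direction `e` of the only ends that go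
upwards with respect to this height. -/
structure IsUpward (Δ : Fin k → Fin 3 → ℤ) (c : Fin 2) (σ : ℤ) (e : Fin 3 → ℤ) : Prop where
  sign : σ = 1 ∨ σ = -1
  apply_eq_one : σ * e c.castSucc = 1
  ends : ∀ a, Δ a = e ∨ σ * Δ a c.castSucc ≤ 0
  lines : ∀ s, σ * stdDir s c ≤ 0 ∨ ∀ i : Fin 2, stdDir s i = e i.castSucc

/-- The height function as an additive map on direction vectors. -/
def heightHom (c : Fin 2) (σ : ℤ) : (Fin 3 → ℤ) →+ ℤ where
  toFun v := σ * v c.castSucc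
  map_zero' := by simp
  map_add' u v := by simp [mul_add]

lemma heightHom_apply (c : Fin 2) (σ : ℤ) (v : Fin 3 → ℤ) :
    heightHom c σ v = σ * v c.castSucc := rfl

lemma heightHom_of_isVertical {c : Fin 2} {σ : ℤ} {v : Fin 3 → ℤ} (h : IsVertical v) :
    heightHom c σ v = 0 := by
  rw [heightHom_apply]
  fin_cases c
  · simp [h.1]
  · simp [h.2.1]

lemma height_lt_of_mem_box {c : Fin 2} {σ : ℤ} (hσ : σ = 1 ∨ σ = -1) {q : Fin 2 → ℝ} {ε : ℝ}
    (hq : q ∈ box ε) : σ * q c < ε := by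
  have := abs_lt.1 (hq c)
  rcases hσ with rfl | rfl
  · simpa using this.2
  · push_cast; linarith

lemma proj_apply (q : Fin 3 → ℝ) (c : Fin 2) : proj q c = q c.castSucc := by
  fin_cases c <;> rfl

lemma normalForm_stdDir (s : Fin 3) : ∑ i : Fin 2, normalForm s i * stdDir s i = 0 := by
  simp [normalForm, Fin.sum_univ_two]; ring

/-- The vertices of a contributing stable map do not leave the box in any of the four coordinate
directions: otherwise all the vertices of maximal height could be moved. -/
theorem height_lt (C : StableMap n Δ V) [NeZero n] {S : Conditions n Δ} {ε : ℝ} {c : Fin 2} {σ : ℤ}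
    {e : Fin 3 → ℤ} (hup : IsUpward Δ c σ e) (hη : ∀ f ∈ S.η, S.P f ∈ box ε)
    (hκ : ∀ f ∈ S.κ, (S.L f).vertex ∈ box ε) (hp : ∀ i, proj (S.p i) ∈ box ε)
    (hentries : S.EntriesVertical) (hC : C.Contributes S) (v : V) :
    σ * C.pos v c.castSucc < ε := by
  classical
  obtain ⟨hCp, hCη, ρ, hCκ, hmult⟩ := hC
  set H : V → ℝ := fun v => σ * C.pos v c.castSucc with hH
  set ψ := heightHom c σ with hψ
  obtain ⟨v₀, -, hmax⟩ := Finset.univ.exists_max_image H ⟨v, Finset.mem_univ v⟩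
  by_contra hv
  have hv₀ : ε ≤ H v₀ := (not_lt.1 hv).trans (hmax v (Finset.mem_univ v))
  set M : V → Prop := fun v => H v = H v₀ with hM
  have hψe : ψ e = 1 := hup.apply_eq_one
  have hHadj : ∀ u w, C.graph.Adj u w → H w = H u + C.length s(u, w) * ψ (C.dir u w) := by
    intro u w h
    simp only [hH, hψ, heightHom_apply]
    rw [C.affine u w h]
    push_cast
    ring
  have hdir_le : ∀ u w, M u → C.graph.Adj u w → ψ (C.dir u w) ≤ 0 := by
    intro u w hu h
    have h1 := hHadj u w h
    have h2 := hmax w (Finset.mem_univ w)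
    have h3 : C.length s(u, w) * (ψ (C.dir u w) : ℝ) ≤ 0 := by
      have : H u = H v₀ := hu
      linarith
    have := nonpos_of_mul_nonpos_right h3 (C.length_pos _ h)
    exact_mod_cast this
  have hdir_zero : ∀ u w, M u → M w → C.graph.Adj u w → ψ (C.dir u w) = 0 := by
    intro u w hu hw h
    have h1 := hHadj u w h
    have hu' : H u = H v₀ := hu
    have hw' : H w = H v₀ := hw
    have h3 : C.length s(u, w) * (ψ (C.dir u w) : ℝ) = 0 := by linarith
    exact_mod_cast (mul_eq_zero.1 h3).resolve_left (C.length_pos _ h).ne'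
  have hdir_neg : ∀ u w, M u → ¬ M w → C.graph.Adj u w → ψ (C.dir u w) < 0 := by
    intro u w hu hw h
    refine lt_of_le_of_ne (hdir_le u w hu h) fun h0 => hw ?_
    have h1 := hHadj u w h
    rw [h0] at h1
    simp only [hM] at hu ⊢
    rw [h1, hu]; simp
  set sp : V → Prop := fun v => ∃ a, C.attach (Sum.inr a) = v ∧ Δ a = e with hsp
  set neg : V → Fin 3 → ℤ := fun v =>
    ∑ f ∈ C.flags v with ψ (C.flagDir v f) < 0, C.flagDir v f with hneg
  have hflag_le : ∀ u, M u → ¬ sp u → ∀ f ∈ C.flags u, ψ (C.flagDir u f) ≤ 0 := by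
    rintro u hu hs (w | i | a) hf
    · exact hdir_le u w hu (inl_mem_flags.1 hf)
    · simp [flagDir, endDir]
    · exact (hup.ends a).resolve_left fun h => hs ⟨a, inr_mem_flags.1 hf, h⟩
  have hψsum : ∀ u, ∑ f ∈ C.flags u, ψ (C.flagDir u f) = 0 := fun u => by
    rw [← map_sum, C.sum_flagDir, map_zero]
  have hspecial : ∀ u, M u → ∀ f ∈ C.flags u, ψ (C.flagDir u f) < 0 → sp u := by
    intro u hu f hf hlt
    by_contra hs
    have := Finset.sum_lt_sum (f := fun f => ψ (C.flagDir u f)) (g := fun _ => (0 : ℤ))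
      (hflag_le u hu hs) ⟨f, hf, hlt⟩
    rw [hψsum u, Finset.sum_const_zero] at this
    exact lt_irrefl _ this
  have htri : ∀ u, M u → sp u → ∀ f ∈ C.flags u,
      (ψ (C.flagDir u f) < 0 → neg u = C.flagDir u f) ∧
      (ψ (C.flagDir u f) = 0 → neg u = - (e + C.flagDir u f)) := by
    rintro u hu ⟨a, hau, hae⟩ f hf
    have hcard : (C.flags u).card = 3 := by
      rw [← hau]
      refine C.card_flags_eq_three hmult fun j t hjt => ?_
      have h0 := heightHom_of_isVertical (c := c) (σ := σ) (hentries j t a hjt)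
      rw [hae, ← hψ, hψe] at h0
      exact one_ne_zero h0
    exact trivalent_sum_neg ψ hψe hcard (C.sum_flagDir u) (inr_mem_flags.2 hau) hae hf
  set χ : V → ℤ := fun v => if sp v then 1 else 0 with hχ
  -- The velocities: `e` at top vertices without an outward end, minus the descending flag at those
  -- with one, zero below the top.
  set z : V → Fin 3 → ℤ := fun v => if M v then (if sp v then - neg v else e) else 0 with hz
  -- At a trivalent top vertex, balancing turns minus the descending flag into `e` plus the
  -- horizontal flag, so along edges inside the top level velocities differ by multiples of the
  -- edge.
  have hz_zero : ∀ u, M u → ∀ f ∈ C.flags u, ψ (C.flagDir u f) = 0 →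
      z u = e + χ u • C.flagDir u f := by
    intro u hu f hf h0
    by_cases hs : sp u
    · simp only [hz, hχ, if_pos hu, if_pos hs, (htri u hu hs f hf).2 h0, neg_neg, one_smul]
    · simp only [hz, hχ, if_pos hu, if_neg hs, zero_smul, add_zero]
  have hz_neg : ∀ u w, M u → ¬ M w → C.graph.Adj u w → z u = - C.dir u w := by
    intro u w hu hw h
    have hlt := hdir_neg u w hu hw h
    have hf : Sum.inl w ∈ C.flags u := inl_mem_flags.2 h
    have hs := hspecial u hu _ hf hlt
    simp only [hz, if_pos hu, if_pos hs, (htri u hu hs _ hf).1 hlt]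
    rfl
  set m : Sym2 V → ℝ := Sym2.lift ⟨fun u w => if M u ∧ M w then ((-(χ u + χ w) : ℤ) : ℝ) else
    if M u ∨ M w then 1 else 0, fun u w => by simp only [and_comm, or_comm, add_comm]⟩ with hm
  have hdef : C.IsDeformation (fun v t => (z v t : ℝ)) m := by
    intro u w h t
    simp only [hm, Sym2.lift_mk]
    by_cases hu : M u <;> by_cases hw : M w
    · have h1 := hz_zero u hu _ (inl_mem_flags.2 h) (hdir_zero u w hu hw h)
      have h2 := hz_zero w hw _ (inl_mem_flags.2 h.symm) (hdir_zero w u hw hu h.symm)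
      rw [h1, h2]
      simp only [flagDir, Sum.elim_inl, C.dir_symm h, hu, hw, and_self, if_true, Pi.add_apply,
        Pi.smul_apply, Pi.neg_apply, smul_eq_mul]
      push_cast
      ring
    · rw [hz_neg u w hu hw h]
      simp [hz, hu, hw]
    · rw [hz_neg w u hw hu h.symm, C.dir_symm h]
      simp [hz, hu, hw]
    · simp [hz, hu, hw]
  have hbox : ∀ x, proj (C.pos (C.attach x)) ∈ box ε →
      (fun t => (z (C.attach x) t : ℝ)) = 0 := by
    intro x hx
    have hnot : ¬ M (C.attach x) := fun h => by
      have h1 := height_lt_of_mem_box (c := c) hup.sign hx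
      rw [proj_apply] at h1
      have h2 : H (C.attach x) = H v₀ := h
      exact absurd (hv₀.trans_eq h2.symm) (not_le.2 h1)
    funext t
    simp [hz, hnot]
  have hzero := hdef.eq_zero (right_ne_zero_of_mul hmult)
    (fun i => hbox _ (by rw [hCp]; exact hp i))
    (fun f hf => hbox _ (by rw [hCη f hf]; exact hη f hf)) ?_
  · have hz0 : z v₀ = 0 := by
      funext t
      have h0 : (z v₀ t : ℝ) = 0 := congrFun (congrFun hzero v₀) t
      exact_mod_cast h0
    have hMv₀ : M v₀ := rfl
    -- The velocity at `v₀` is nonzero: it is either `e`, or the negative of a flag that exists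
    -- because something must balance the outward end.
    by_cases hs : sp v₀
    · simp only [hz, if_pos hMv₀, if_pos hs, neg_eq_zero] at hz0
      have hs' := hs
      obtain ⟨a, ha, hae⟩ := hs'
      have hmem : Sum.inr (Sum.inr a) ∈ C.flags v₀ := inr_mem_flags.2 ha
      by_cases hex : ∃ f ∈ C.flags v₀, ψ (C.flagDir v₀ f) < 0
      · obtain ⟨f, hf, hlt⟩ := hex
        have h1 := (htri v₀ hMv₀ hs f hf).1 hlt
        rw [hz0] at h1
        rw [← h1, map_zero] at hlt
        exact lt_irrefl _ hlt
      · push Not at hex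
        have h1 := Finset.single_le_sum hex hmem
        rw [hψsum] at h1
        have h2 : ψ (C.flagDir v₀ (Sum.inr (Sum.inr a))) = 1 := by
          simp only [flagDir, endDir, Sum.elim_inr, hae, hψe]
        omega
    · simp only [hz, if_pos hMv₀, if_neg hs] at hz0
      rw [hz0, map_zero] at hψe
      exact zero_ne_one hψe
  · intro f hf
    set w := C.attach (Sum.inr f) with hw
    by_cases hMw : M w
    · obtain ⟨t, ht, hq⟩ := hCκ f hf
      -- The multi line has its vertex in the box, so it reaches the top level only along its end of
      -- direction `e`. The velocity projects to this direction because `f` is vertical.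
      have hvert := S.κ_vertical f hf
      have hline : ∀ i : Fin 2, stdDir (ρ f) i = e i.castSucc := by
        refine (hup.lines (ρ f)).resolve_left fun hle => ?_
        have h1 := height_lt_of_mem_box (c := c) hup.sign (hκ f hf)
        have h2 := hq c
        rw [proj_apply] at h2
        have h3 : H w = H v₀ := hMw
        have h4 : H w = σ * (S.L f).vertex c + t * ((σ * stdDir (ρ f) c : ℤ) : ℝ) := by
          simp only [hH]
          rw [h2]; push_cast; ring
        have h5 : t * ((σ * stdDir (ρ f) c : ℤ) : ℝ) ≤ 0 :=
          mul_nonpos_of_nonneg_of_nonpos ht (by exact_mod_cast hle)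
        linarith
      have h1 := hz_zero w hMw (Sum.inr (Sum.inr f)) (inr_mem_flags.2 rfl)
        (heightHom_of_isVertical hvert)
      have h2 : ∀ i : Fin 2, z w i.castSucc = stdDir (ρ f) i := by
        intro i
        have h3 : Δ f i.castSucc = 0 := by
          fin_cases i
          exacts [hvert.1, hvert.2.1]
        rw [h1, hline]
        simp [flagDir, endDir, h3]
      simp only [h2]
      exact_mod_cast normalForm_stdDir (ρ f)
    · simp [hz, hMw]

end StableMap

end TropCurve

namespace TropCurve

namespace StableMap

variable {n k : ℕ} {Δ : Fin k → Fin 3 → ℤ} {V : Type*} [Fintype V]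

/-! ### Bounds on the combinatorial types -/

/-- Counting valences in a tree gives `3 * |V| ≤ 2 * (|V| - 1) + n + k`. -/
lemma card_add_two_le (C : StableMap n Δ V) : Fintype.card V + 2 ≤ n + k := by
  classical
  have h1 : ∑ v, C.graph.degree v = 2 * C.graph.edgeFinset.card :=
    C.graph.sum_degrees_eq_twice_card_edges
  have h2 := C.isTree.card_edgeFinset
  have h3 : ∑ v, (Finset.univ.filter fun x => C.attach x = v).card = n + k := by
    rw [← Finset.card_eq_sum_card_fiberwise (s := Finset.univ) (t := Finset.univ) (f := C.attach)
      (fun x _ => Finset.mem_coe.2 (Finset.mem_univ _))]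
    simp
  have h4 : ∑ _v : V, 3 ≤
      ∑ v, (C.graph.degree v + (Finset.univ.filter fun x => C.attach x = v).card) := by
    refine Finset.sum_le_sum fun v _ => ?_
    have := C.three_le_valence v
    rw [← C.graph.card_neighborFinset_eq_degree, C.graph.neighborFinset_eq_filter]
    convert this
  rw [Finset.sum_add_distrib, h1, h3] at h4
  simp at h4
  omega

/-- The direction vector of a bounded edge is determined by the ends on one side of it. -/
lemma dir_eq_sum_side (C : StableMap n Δ V) {u w : V} (h : C.graph.Adj u w) :
    C.dir u w = ∑ x ∈ C.side u w, endDir Δ x := by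
  classical
  set R : Finset V :=
    Finset.univ.filter fun v => (C.graph.deleteEdges {s(u, w)}).Reachable w v with hR
  have hmem : ∀ v, v ∈ R ↔ (C.graph.deleteEdges {s(u, w)}).Reachable w v := by simp [hR]
  have hw : w ∈ R := (hmem w).2 (SimpleGraph.Reachable.refl _)
  have hu : u ∉ R := by
    rw [hmem]
    intro hr
    have := SimpleGraph.isAcyclic_iff_forall_adj_isBridge.1 C.isTree.isAcyclic h
    rw [SimpleGraph.isBridge_iff] at this
    exact this hr.symm
  set g : V → V → Fin 3 → ℤ := fun v z => if C.graph.Adj v z then C.dir v z else 0 with hg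
  have hanti : ∀ v z, g v z = - g z v := by
    intro v z
    by_cases hvz : C.graph.Adj v z
    · simp [hg, hvz, hvz.symm, C.dir_symm hvz]
    · have hzv : ¬ C.graph.Adj z v := fun h' => hvz h'.symm
      simp [hg, hvz, hzv]
  -- Balancing is summed over the component `R` of `w`: inner edges cancel, and only the removed
  -- edge and the ends remain.
  have hin : ∑ v ∈ R, ∑ z ∈ R, g v z = 0 := by
    have : ∑ v ∈ R, ∑ z ∈ R, g v z = - ∑ v ∈ R, ∑ z ∈ R, g v z := by
      conv_lhs => rw [Finset.sum_comm]
      simp only [← Finset.sum_neg_distrib]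
      exact Finset.sum_congr rfl fun v _ => Finset.sum_congr rfl fun z _ => hanti z v
    exact self_eq_neg.1 this
  have hcross : ∀ v ∈ R, ∀ z ∈ Rᶜ, g v z ≠ 0 → v = w ∧ z = u := by
    intro v hv z hz hne
    have hadj : C.graph.Adj v z := by
      by_contra hna; exact hne (by simp [hg, hna])
    have hz' : z ∉ R := by simpa using hz
    by_cases he : s(v, z) = s(u, w)
    · rcases Sym2.eq_iff.1 he with ⟨h1, h2⟩ | h'
      · exact absurd (h2 ▸ hw) hz'
      · exact h'
    · refine absurd ((hmem z).2 (((hmem v).1 hv).trans (SimpleGraph.Adj.reachable ?_))) hz'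
      rw [SimpleGraph.deleteEdges_adj]
      exact ⟨hadj, he⟩
  have hout : ∑ v ∈ R, ∑ z ∈ Rᶜ, g v z = C.dir w u := by
    rw [Finset.sum_eq_single_of_mem w hw, Finset.sum_eq_single_of_mem u (by simpa using hu)]
    · simp [hg, h.symm]
    · intro z hz hne
      by_contra h0
      exact hne (hcross w hw z hz h0).2
    · intro v hv hne
      refine Finset.sum_eq_zero fun z hz => ?_
      by_contra h0
      exact hne (hcross v hv z hz h0).1
  have hall : ∑ v ∈ R, ∑ z, g v z = C.dir w u := by
    rw [← hout, ← zero_add (∑ v ∈ R, ∑ z ∈ Rᶜ, g v z), ← hin, ← Finset.sum_add_distrib]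
    exact Finset.sum_congr rfl fun v _ => (Finset.sum_add_sum_compl R _).symm
  have hends : ∑ v ∈ R, ∑ x ∈ Finset.univ.filter (fun x => C.attach x = v), endDir Δ x =
      ∑ x ∈ C.side u w, endDir Δ x := by
    have hmaps : ∀ x ∈ C.side u w, C.attach x ∈ R := fun x hx => by
      rw [hmem]; simpa [side] using hx
    rw [← Finset.sum_fiberwise_of_maps_to hmaps]
    refine Finset.sum_congr rfl fun v hv => Finset.sum_congr ?_ fun _ _ => rfl
    ext x
    simp only [side, Finset.mem_filter, Finset.mem_univ, true_and]
    exact ⟨fun hx => ⟨hx ▸ (hmem v).1 hv, hx⟩, fun hx => hx.2⟩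
  have hbal : ∑ v ∈ R, ((∑ z, g v z) +
      ∑ x ∈ Finset.univ.filter (fun x => C.attach x = v), endDir Δ x) = 0 := by
    refine Finset.sum_eq_zero fun v _ => ?_
    have := C.balanced v
    rw [Finset.sum_filter] at this
    convert this
  rw [Finset.sum_add_distrib, hall, hends, C.dir_symm h] at hbal
  exact (neg_add_eq_zero.1 hbal)

lemma abs_dir_le (C : StableMap n Δ V) {u w : V} (h : C.graph.Adj u w) (t : Fin 3) :
    |C.dir u w t| ≤ ∑ a, |Δ a t| := by
  rw [C.dir_eq_sum_side h, Finset.sum_apply]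
  calc _ ≤ ∑ x ∈ C.side u w, |endDir Δ x t| := Finset.abs_sum_le_sum_abs _ _
    _ ≤ ∑ x : Label n k, |endDir Δ x t| :=
      Finset.sum_le_sum_of_subset_of_nonneg (Finset.subset_univ _) fun _ _ _ => abs_nonneg _
    _ = _ := by simp [Fintype.sum_sum_type, endDir]

/-! ### Floors -/

/-- On a stable map over a box, the `z`-coordinate changes by a bounded amount along each edge of a
floor. -/
lemma abs_sub_le_of_floorGraph_adj (C : StableMap n Δ V) {ε : ℝ}
    (hbox : ∀ v, proj (C.pos v) ∈ box ε) {u w : V} (h : C.floorGraph.Adj u w) :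
    |C.pos w 2 - C.pos u 2| ≤ 2 * ε * (∑ a, |Δ a 2| : ℤ) := by
  obtain ⟨hadj, hvert, -⟩ := h
  have hl := C.length_pos s(u, w) hadj
  have hε : 0 < ε := (abs_nonneg _).trans_lt (hbox u 0)
  have hD : |(C.dir u w 2 : ℝ)| ≤ (∑ a, |Δ a 2| : ℤ) := by
    exact_mod_cast C.abs_dir_le hadj 2
  have hz : C.pos w 2 - C.pos u 2 = C.length s(u, w) * C.dir u w 2 := by
    rw [C.affine u w hadj 2]; ring
  rw [hz, abs_mul, abs_of_pos hl]
  -- This case includes contracted edges, which are not vertical and whose length is not controlled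
  -- by the box.
  by_cases h2 : C.dir u w 2 = 0
  · rw [h2, Int.cast_zero, abs_zero, mul_zero]
    exact mul_nonneg (by linarith) ((abs_nonneg _).trans hD)
  have hc : ∃ c : Fin 2, C.dir u w c.castSucc ≠ 0 := by
    by_contra! hcon
    exact hvert ⟨hcon 0, hcon 1, h2⟩
  obtain ⟨c, hc⟩ := hc
  have hlen : C.length s(u, w) ≤ 2 * ε := by
    have h1 : (1 : ℝ) ≤ |(C.dir u w c.castSucc : ℝ)| := by
      exact_mod_cast Int.one_le_abs hc
    have h3 : C.pos w c.castSucc - C.pos u c.castSucc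
        = C.length s(u, w) * C.dir u w c.castSucc := by
      rw [C.affine u w hadj]; ring
    have h4 := hbox u c
    have h5 := hbox w c
    rw [proj_apply] at h4 h5
    calc C.length s(u, w) ≤ C.length s(u, w) * |(C.dir u w c.castSucc : ℝ)| :=
          le_mul_of_one_le_right hl.le h1
      _ = |C.pos w c.castSucc - C.pos u c.castSucc| := by rw [h3, abs_mul, abs_of_pos hl]
      _ ≤ |C.pos w c.castSucc| + |C.pos u c.castSucc| := abs_sub _ _
      _ ≤ 2 * ε := by linarith
  exact mul_le_mul hlen hD (abs_nonneg _) (by linarith)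

lemma abs_sub_le_of_floorGraph_walk (C : StableMap n Δ V) {ε : ℝ}
    (hbox : ∀ v, proj (C.pos v) ∈ box ε) {u w : V} (p : C.floorGraph.Walk u w) :
    |C.pos w 2 - C.pos u 2| ≤ p.length * (2 * ε * (∑ a, |Δ a 2| : ℤ)) := by
  induction p with
  | nil => simp
  | cons h p ih =>
    have h1 := C.abs_sub_le_of_floorGraph_adj hbox h
    refine (abs_sub_le _ _ _).trans ((add_le_add ih h1).trans_eq ?_)
    rw [SimpleGraph.Walk.length_cons]
    push_cast
    ring

lemma abs_sub_le_of_floorGraph_reachable (C : StableMap n Δ V) {ε : ℝ}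
    (hbox : ∀ v, proj (C.pos v) ∈ box ε) {u w : V} (h : C.floorGraph.Reachable u w) :
    |C.pos w 2 - C.pos u 2| ≤ (n + k : ℕ) * (2 * ε * (∑ a, |Δ a 2| : ℤ)) := by
  classical
  obtain ⟨p⟩ := h
  have hε : 0 < ε := (abs_nonneg _).trans_lt (hbox u 0)
  -- A path without repetitions is shorter than the number of vertices, which the number of ends
  -- bounds.
  have hlen := p.toPath.2.length_lt
  have hcard := C.card_add_two_le
  refine (C.abs_sub_le_of_floorGraph_walk hbox p.toPath).trans ?_
  refine mul_le_mul_of_nonneg_right (by exact_mod_cast (by omega)) ?_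
  exact mul_nonneg (by linarith) (by exact_mod_cast Finset.sum_nonneg fun _ _ => abs_nonneg _)

end StableMap

/-! ### The degree -/

lemma mem_spaceDegree {d : ℕ} {α β : ℕ+ →₀ ℕ} {v : Fin 3 → ℤ} (h : v ∈ spaceDegree d α β) :
    v = ![1, 1, 1] ∨ v = ![-1, 0, 0] ∨ v = ![0, -1, 0] ∨ (v 0 = 0 ∧ v 1 = 0) := by
  have hsum : ∀ (γ : ℕ+ →₀ ℕ) (f : ℕ+ → ℤ),
      v ∈ γ.sum (fun i a => Multiset.replicate a ![0, 0, f i]) → v 0 = 0 ∧ v 1 = 0 := by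
    intro γ f hv
    rw [Finsupp.sum, Multiset.mem_sum] at hv
    obtain ⟨i, -, hi⟩ := hv
    rw [Multiset.eq_of_mem_replicate hi]
    exact ⟨rfl, rfl⟩
  simp only [spaceDegree, Multiset.mem_add] at h
  rcases h with (((h | h) | h) | h) | h
  · exact .inl (Multiset.eq_of_mem_replicate h)
  · exact .inr (.inl (Multiset.eq_of_mem_replicate h))
  · exact .inr (.inr (.inl (Multiset.eq_of_mem_replicate h)))
  · exact .inr (.inr (.inr (hsum α _ h)))
  · exact .inr (.inr (.inr (hsum β _ h)))

section Degree

variable {d : ℕ} {α β : ℕ+ →₀ ℕ} {k : ℕ} {Δ : Fin k → Fin 3 → ℤ}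

lemma IsLabelledDegree.mem (h : IsLabelledDegree d α β Δ) (a : Fin k) :
    Δ a = ![1, 1, 1] ∨ Δ a = ![-1, 0, 0] ∨ Δ a = ![0, -1, 0] ∨ (Δ a 0 = 0 ∧ Δ a 1 = 0) := by
  refine mem_spaceDegree (d := d) (α := α) (β := β) ?_
  rw [← h]
  exact Multiset.mem_map_of_mem _ (Finset.mem_univ a)

lemma IsLabelledDegree.card_eq (h : IsLabelledDegree d α β Δ) :
    k = (spaceDegree d α β).card := by
  rw [← h]; simp

lemma IsLabelledDegree.sum_abs_eq (h : IsLabelledDegree d α β Δ) :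
    ∑ a, |Δ a 2| = ((spaceDegree d α β).map fun v => |v 2|).sum := by
  rw [← h, Multiset.map_map]; rfl

/-- Both positive directions are served by `(1,1,1)`; each negative one has its own standard end. -/
lemma IsLabelledDegree.isUpward (h : IsLabelledDegree d α β Δ) :
    (∀ c, StableMap.IsUpward Δ c 1 ![1, 1, 1]) ∧ StableMap.IsUpward Δ 0 (-1) ![-1, 0, 0] ∧
      StableMap.IsUpward Δ 1 (-1) ![0, -1, 0] := by
  refine ⟨fun c => ⟨.inl rfl, ?_, fun a => ?_, fun s => ?_⟩, ⟨.inr rfl, ?_, fun a => ?_, fun s => ?_⟩,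
    ⟨.inr rfl, ?_, fun a => ?_, fun s => ?_⟩⟩
  · fin_cases c <;> rfl
  · rcases h.mem a with h | h | h | h
    · exact .inl h
    · right; rw [h]; fin_cases c <;> simp
    · right; rw [h]; fin_cases c <;> simp
    · right; fin_cases c <;> simp [h.1, h.2]
  · revert c s; decide
  · rfl
  · rcases h.mem a with h | h | h | h
    · right; rw [h]; simp
    · exact .inl h
    · right; rw [h]; simp
    · right; simp [h.1]
  · revert s; decide
  · rfl
  · rcases h.mem a with h | h | h | h
    · right; rw [h]; simp
    · right; rw [h]; simp
    · exact .inl h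
    · right; simp [h.2]
  · revert s; decide

/-- All the vertices of a contributing stable map lie over the box. -/
theorem StableMap.proj_pos_mem_box {n : ℕ} [NeZero n] {V : Type*} [Fintype V]
    (h : IsLabelledDegree d α β Δ) {S : Conditions n Δ} {c ε : ℝ} (hS : S.Stretched c ε)
    (hentries : S.EntriesVertical) {C : StableMap n Δ V} (hC : C.Contributes S) (v : V) :
    proj (C.pos v) ∈ box ε := by
  obtain ⟨hη, hκ, hp, -⟩ := hS
  obtain ⟨h1, h2, h3⟩ := h.isUpward
  intro i
  rw [StableMap.proj_apply, abs_lt]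
  have hi := C.height_lt (h1 i) hη hκ hp hentries hC v
  have h0 := C.height_lt h2 hη hκ hp hentries hC v
  have h1 := C.height_lt h3 hη hκ hp hentries hC v
  push_cast at hi h0 h1
  refine ⟨?_, by linarith⟩
  fin_cases i
  · change -ε < C.pos v 0; linarith
  · change -ε < C.pos v 1; linarith

end Degree

end TropCurve

theorem mainTheorem5 (d : ℕ) (α β : ℕ+ →₀ ℕ) (hd : TropCurve.IsBalancedDegree d α β)
    (n : ℕ) [NeZero n] :
    ∃ c : ℝ, 0 < c ∧
      ∀ (k : ℕ) (Δ : Fin k → Fin 3 → ℤ), TropCurve.IsLabelledDegree d α β Δ →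
      ∀ (S : TropCurve.Conditions n Δ) (ε : ℝ), 0 < ε → S.Stretched c ε → S.EntriesVertical →
      ∀ (V : Type*) [Fintype V] (C : TropCurve.StableMap n Δ V),
        C.Contributes S → C.FloorDecomposed := by
  set N : ℕ := n + (TropCurve.spaceDegree d α β).card
  set D : ℤ := ((TropCurve.spaceDegree d α β).map fun v => |v 2|).sum with hDdef
  have hD : 0 ≤ D := Multiset.sum_nonneg fun x hx => by
    obtain ⟨v, -, rfl⟩ := Multiset.mem_map.1 hx
    exact abs_nonneg _
  have hD' : (0 : ℝ) ≤ D := by exact_mod_cast hD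
  -- At most `N` edges of a floor, each changing `z` by at most `2 * ε * D`; the `+ 1` keeps the
  -- constant positive when `D` is zero.
  refine ⟨N * (2 * D) + 1, by positivity, ?_⟩
  intro k Δ hΔ S ε hε hS hentries V _ C hC i j hij
  by_contra hne
  have hbox := TropCurve.StableMap.proj_pos_mem_box hΔ hS hentries hC
  have hle := C.abs_sub_le_of_floorGraph_reachable hbox
    (SimpleGraph.ConnectedComponent.exact hij).symm
  have hlt := hS.2.2.2 i j hne
  have hk : n + k = N := congrArg (n + ·) hΔ.card_eq
  rw [hC.1, hC.1, hΔ.sum_abs_eq, ← hDdef, hk] at hle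
  linarith
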